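/- Let $I=[0,1]$ and let $C(I)$ be the space of continuous maps $f:I\to I$ with the supremum metric. For $f\in C(I)$ let $h_{top}(f)\in[0,+\infty]$ be its topological entropy, defined by open covers: $h_{top}(f)=\sup_{\alpha}\lim_{n\to\infty}\frac1n\log N(\alpha\vee f^{-1}(\alpha)\vee\cdots\vee f^{-(n-1)}(\alpha))$, where the supremum is over all open covers $\alpha$ of $I$, $\alpha\vee\beta=\{U\cap V: U\in\alpha, V\in\beta\}$, $f^{-1}(\alpha)=\{f^{-1}(U):U\in\alpha\}$, and $N(\beta)$ is the least number of members of $\beta$ that cover $I$. Call $f\in C(I)$ piecewise monotone if there are $0=t_0<t_1<\cdots<t_n=1$ such that $f|_{[t_{i-1},t_i]}$ is monotone (non-decreasing or non-increasing) for every $i=1,\dots,n$. Then there exists a continuous map $H:C(I)\times I\to C(I)$, $(f,t)\mapsto H_t(f)$, such that 1. $H_0(f)=f$ for every $f\in C(I)$; 2. for every $t\in(0,1)$ and every $f\in C(I)$, $h_{top}(H_t(f))\le h_{top}(f)$ and $H_t(f)$ is piecewise monotone; 3. for every $f\in C(I)$, $H_1(f)$ is the constant map $0$. -/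

import Mathlib

open Filter Topology unitInterval

/-- `α` is an open cover of the space `X`. -/
def IsOpenCoverFamily {X : Type*} [TopologicalSpace X] (α : Set (Set X)) : Prop :=
  (∀ U ∈ α, IsOpen U) ∧ ⋃₀ α = Set.univ

/-- `N(α)`: the least number of members of `α` that cover `X`. (The set of such numbers is
non-empty whenever `α` is an open cover of a compact space.) -/
noncomputable def coverNumber {X : Type*} (α : Set (Set X)) : ℕ :=
  sInf {n : ℕ | ∃ s : Finset (Set X), (s : Set (Set X)) ⊆ α ∧
    ⋃₀ (s : Set (Set X)) = Set.univ ∧ s.card = n}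

/-- The join `α ∨ f⁻¹(α) ∨ ⋯ ∨ f⁻⁽ⁿ⁻¹⁾(α)`: all sets
`U₀ ∩ f⁻¹(U₁) ∩ ⋯ ∩ f⁻⁽ⁿ⁻¹⁾(Uₙ₋₁)` with `U₀, …, Uₙ₋₁ ∈ α`. -/
def iteratedJoin {X : Type*} (f : X → X) (α : Set (Set X)) (n : ℕ) : Set (Set X) :=
  {W | ∃ U : Fin n → Set X, (∀ i, U i ∈ α) ∧ W = ⋂ i : Fin n, f^[(i : ℕ)] ⁻¹' (U i)}

/-- The entropy of `f` with respect to the cover `α`: the limit of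
`log N(α ∨ f⁻¹(α) ∨ ⋯ ∨ f⁻⁽ⁿ⁻¹⁾(α)) / n` as `n → ∞`. It is written as an upper limit; for a
continuous map of a compact space and an open cover the limit exists, see
`tendsto_coverEntropyWith`. -/
noncomputable def coverEntropyWith {X : Type*} (f : X → X) (α : Set (Set X)) : EReal :=
  limsup (fun n : ℕ => ((Real.log (coverNumber (iteratedJoin f α n)) / n : ℝ) : EReal)) atTop

/-- An open cover of a compact space has a finite subcover, of minimal size `coverNumber`. -/
theorem exists_card_eq_coverNumber {X : Type*} [TopologicalSpace X] [CompactSpace X]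
    {α : Set (Set X)} (hα : IsOpenCoverFamily α) :
    ∃ s : Finset (Set X), (s : Set (Set X)) ⊆ α ∧ ⋃₀ (s : Set (Set X)) = Set.univ ∧
      s.card = coverNumber α := by
  refine Nat.sInf_mem (s := {n : ℕ | ∃ s : Finset (Set X), (s : Set (Set X)) ⊆ α ∧
    ⋃₀ (s : Set (Set X)) = Set.univ ∧ s.card = n}) ?_
  obtain ⟨t, ht, hfin, hcov⟩ := isCompact_univ.elim_finite_subcover_image (b := α) (c := id)
    hα.1 (by simp only [id, ← Set.sUnion_eq_biUnion, hα.2, subset_rfl])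
  refine ⟨_, hfin.toFinset, by simpa using ht, ?_, rfl⟩
  simp only [id, ← Set.sUnion_eq_biUnion] at hcov
  simpa using Set.univ_subset_iff.1 hcov

theorem coverNumber_le {X : Type*} {α : Set (Set X)} {s : Finset (Set X)}
    (hs : (s : Set (Set X)) ⊆ α) (hc : ⋃₀ (s : Set (Set X)) = Set.univ) :
    coverNumber α ≤ s.card :=
  Nat.sInf_le ⟨s, hs, hc, rfl⟩

theorem IsOpenCoverFamily.iteratedJoin {X : Type*} [TopologicalSpace X] {f : X → X}
    (hf : Continuous f) {α : Set (Set X)} (hα : IsOpenCoverFamily α) (n : ℕ) :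
    IsOpenCoverFamily (iteratedJoin f α n) := by
  constructor
  · rintro _ ⟨U, hU, rfl⟩
    exact isOpen_iInter_of_finite fun i => (hα.1 _ (hU i)).preimage (hf.iterate _)
  · rw [Set.eq_univ_iff_forall]
    intro x
    have h : ∀ y, ∃ U ∈ α, y ∈ U := fun y => by
      have : y ∈ ⋃₀ α := hα.2 ▸ Set.mem_univ y
      simpa using this
    choose V hV hyV using h
    exact ⟨_, ⟨fun i => V (f^[(i : ℕ)] x), fun i => hV _, rfl⟩,
      Set.mem_iInter.2 fun i => hyV _⟩

theorem coverNumber_iteratedJoin_add_le {X : Type*} [TopologicalSpace X] [CompactSpace X]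
    {f : X → X} (hf : Continuous f) {α : Set (Set X)} (hα : IsOpenCoverFamily α) (m n : ℕ) :
    coverNumber (iteratedJoin f α (m + n)) ≤
      coverNumber (iteratedJoin f α m) * coverNumber (iteratedJoin f α n) := by
  classical
  obtain ⟨s, hs, hsc, hsn⟩ := exists_card_eq_coverNumber (hα.iteratedJoin hf m)
  obtain ⟨t, ht, htc, htn⟩ := exists_card_eq_coverNumber (hα.iteratedJoin hf n)
  rw [← hsn, ← htn]
  refine le_trans (coverNumber_le (s := Finset.image₂ (fun A B => A ∩ f^[m] ⁻¹' B) s t) ?_ ?_)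
    (Finset.card_image₂_le _ _ _)
  · intro W hW
    obtain ⟨A, hA, B, hB, rfl⟩ := Finset.mem_image₂.1 (Finset.mem_coe.1 hW)
    obtain ⟨U, hU, rfl⟩ := hs hA
    obtain ⟨V, hV, rfl⟩ := ht hB
    refine ⟨Fin.append U V, fun i => ?_, ?_⟩
    · refine Fin.addCases (fun j => ?_) (fun j => ?_) i
      · simpa using hU j
      · simpa using hV j
    · ext x
      simp only [Set.mem_inter_iff, Set.mem_iInter, Set.mem_preimage]
      constructor
      · rintro ⟨h1, h2⟩ i
        refine Fin.addCases (fun j => ?_) (fun j => ?_) i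
        · simpa using h1 j
        · have := h2 j
          rw [← Function.iterate_add_apply, add_comm] at this
          simpa using this
      · intro h
        refine ⟨fun j => ?_, fun j => ?_⟩
        · simpa using h (Fin.castAdd n j)
        · have := h (Fin.natAdd m j)
          rw [← Function.iterate_add_apply, add_comm]
          simpa using this
  · rw [Set.eq_univ_iff_forall]
    intro x
    obtain ⟨A, hA, hxA⟩ : x ∈ ⋃₀ (s : Set (Set X)) := hsc ▸ Set.mem_univ x
    obtain ⟨B, hB, hxB⟩ : f^[m] x ∈ ⋃₀ (t : Set (Set X)) := htc ▸ Set.mem_univ _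
    exact ⟨A ∩ f^[m] ⁻¹' B, Finset.mem_coe.2 (Finset.mem_image₂.2 ⟨A, hA, B, hB, rfl⟩),
      hxA, hxB⟩

/-- The limit defining the entropy with respect to an open cover exists, in `ℝ`. -/
theorem tendsto_coverEntropyWith {X : Type*} [TopologicalSpace X] [CompactSpace X]
    {f : X → X} (hf : Continuous f) {α : Set (Set X)} (hα : IsOpenCoverFamily α) :
    ∃ l : ℝ, coverEntropyWith f α = l ∧
      Tendsto (fun n : ℕ => Real.log (coverNumber (iteratedJoin f α n)) / n) atTop (𝓝 l) := by
  have hsub : Subadditive fun n : ℕ => Real.log (coverNumber (iteratedJoin f α n)) := by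
    intro m n
    have h := coverNumber_iteratedJoin_add_le hf hα m n
    rcases Nat.eq_zero_or_pos (coverNumber (iteratedJoin f α (m + n))) with h0 | h0
    · simp only [h0, Nat.cast_zero, Real.log_zero]
      exact add_nonneg (Real.log_natCast_nonneg _) (Real.log_natCast_nonneg _)
    · have hpos := lt_of_lt_of_le h0 h
      have h1 := Nat.pos_of_mul_pos_right hpos
      have h2 := Nat.pos_of_mul_pos_left hpos
      rw [← Real.log_mul (by positivity) (by positivity)]
      exact Real.log_le_log (by exact_mod_cast h0) (by exact_mod_cast h)
  have hlim := hsub.tendsto_lim ⟨0, by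
    rintro _ ⟨n, rfl⟩
    exact div_nonneg (Real.log_natCast_nonneg _) (Nat.cast_nonneg _)⟩
  exact ⟨hsub.lim, ((continuous_coe_real_ereal.tendsto _).comp hlim).limsup_eq, hlim⟩

/-- The topological entropy (defined by open covers) of a continuous self-map of a compact
space: the supremum over all open covers of the entropy with respect to the cover. -/
noncomputable def topEntropy {X : Type*} [TopologicalSpace X] [CompactSpace X] (f : C(X, X)) :
    EReal :=
  ⨆ (α : Set (Set X)) (_ : IsOpenCoverFamily α), coverEntropyWith f α

/-- `f` is piecewise monotone: there are `0 = t₀ < t₁ < ⋯ < tₙ = 1` such that `f` is monotone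
(non-decreasing or non-increasing) on each `[tᵢ₋₁, tᵢ]`. -/
def IsPiecewiseMonotone (f : C(I, I)) : Prop :=
  ∃ (n : ℕ) (t : Fin (n + 1) → I), StrictMono t ∧ t 0 = 0 ∧ t (Fin.last n) = 1 ∧
    ∀ i : Fin n, MonotoneOn f (Set.Icc (t i.castSucc) (t i.succ)) ∨
      AntitoneOn f (Set.Icc (t i.castSucc) (t i.succ))

/-! Take `H_t(f) = min (flattenMesh f t, 1 - t)`: flatten `f` to a monotone map on each interval of
a grid of mesh `t`, then cut off at a level that falls from 1 to 0.

Entropy is controlled by `topEntropy_le_of_locally_const`: if `g` is locally constant wherever it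
differs from `f`, then `g` takes only finitely many values, say `m`, at points where it is `ε`-far
from `f`. An orbit of `g` is an `ε`-pseudo-orbit of `f` up to its first far point, then one of `m`
fixed orbits. For small `ε` this costs at most a factor `1 + n * m` in the number of itineraries,
which is subexponential. Each flattening and the cutoff are modifications of this kind.

For continuity, near `t > 0` a fixed finite number of flattenings suffices; at `t = 0` this number
is unbounded, but the flattened map takes at `x` a value of `f` within distance `t` of `x`. -/

/-! ### Entropy and maps that are locally constant where they differ from a given map -/

section Entropy

variable {X : Type*} [MetricSpace X] [CompactSpace X]

/-- For `ε` small, the `α`-itineraries of length `L` of `ε`-pseudo-orbits of `f` are covered by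
as few words as those of genuine orbits. -/
theorem exists_words_pseudoOrbit_block (f : C(X, X)) {α : Set (Set X)}
    (hα : IsOpenCoverFamily α) (L : ℕ) :
    ∃ ε > 0, ∃ s : Finset (ℕ → Set X), s.card ≤ coverNumber (iteratedJoin f α L) ∧
      (∀ w ∈ s, ∀ i, w i ∈ α) ∧ ∀ x : ℕ → X, (∀ i, dist (x (i + 1)) (f (x i)) < ε) →
        ∃ w ∈ s, ∀ i < L, x i ∈ w i := by
  classical
  rcases isEmpty_or_nonempty X with hX | ⟨⟨x₀⟩⟩
  · exact ⟨1, one_pos, ∅, by simp, by simp, fun x => (hX.false (x 0)).elim⟩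
  obtain ⟨A, hA, -⟩ : ∃ A ∈ α, x₀ ∈ A := by
    have : x₀ ∈ ⋃₀ α := hα.2 ▸ Set.mem_univ x₀
    simpa using this
  obtain ⟨t, ht, htc, htn⟩ := exists_card_eq_coverNumber (hα.iteratedJoin f.continuous L)
  have hword : ∀ W ∈ t, ∃ w : ℕ → Set X, (∀ i, w i ∈ α) ∧
      W ⊆ {x | ∀ i < L, f^[i] x ∈ w i} := by
    intro W hW
    obtain ⟨U, hU, rfl⟩ := ht hW
    -- Only the first `L` letters matter; `A` pads the word to an infinite sequence in `α`.
    refine ⟨fun i => if h : i < L then U ⟨i, h⟩ else A, fun i => ?_, fun x hx i hi => ?_⟩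
    · dsimp only
      split_ifs
      exacts [hU _, hA]
    · simpa [hi] using Set.mem_iInter.1 hx ⟨i, hi⟩
  choose! word hwα hw using hword
  have hopen : ∀ w ∈ t.image word, ∀ i, w i ∈ α := by
    intro w hw'
    obtain ⟨W, hW, rfl⟩ := Finset.mem_image.1 hw'
    exact hwα W hW
  -- The sequences following no word form a compact set. The total error over `L` steps is positive
  -- on it, since zero error means a genuine orbit, so it is bounded below by some `δ > 0`.
  let D : Set (ℕ → X) := (⋃ w ∈ t.image word, ⋂ i ∈ Finset.range L, {x | x i ∈ w i})ᶜ
  have hD : IsCompact D := by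
    refine IsClosed.isCompact (isOpen_biUnion fun w hw' => ?_).isClosed_compl
    exact isOpen_biInter_finset fun i _ => (hα.1 _ (hopen w hw' i)).preimage (continuous_apply i)
  have hcont : Continuous fun x : ℕ → X =>
      ∑ i ∈ Finset.range L, dist (x (i + 1)) (f (x i)) := by fun_prop
  obtain ⟨δ, hδ, hmin⟩ := hD.exists_forall_le' hcont.continuousOn (a := 0) fun x hx => by
    by_contra hle
    apply hx
    have hzero : ∀ i ∈ Finset.range L, dist (x (i + 1)) (f (x i)) = 0 :=
      (Finset.sum_eq_zero_iff_of_nonneg fun _ _ => dist_nonneg).1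
        (le_antisymm (not_lt.1 hle) (Finset.sum_nonneg fun _ _ => dist_nonneg))
    have horb : ∀ i ≤ L, x i = f^[i] (x 0) := by
      intro i
      induction i with
      | zero => simp
      | succ i ih =>
        intro hi
        rw [Function.iterate_succ_apply', ← ih (by omega)]
        exact dist_eq_zero.1 (hzero i (Finset.mem_range.2 hi))
    obtain ⟨W, hW, hxW⟩ : x 0 ∈ ⋃₀ (t : Set (Set X)) := htc ▸ Set.mem_univ _
    refine Set.mem_biUnion (Finset.mem_image_of_mem word hW) ?_
    simp only [Set.mem_iInter, Finset.mem_range, Set.mem_ofPred_eq]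
    intro i hi
    rw [horb i hi.le]
    exact hw W hW hxW i hi
  -- `L` errors below this size add up to less than `δ`; the `+ 1` gives strictness and covers `L =
  -- 0`.
  refine ⟨δ / (L + 1), by positivity, t.image word, htn ▸ Finset.card_image_le, hopen, ?_⟩
  intro x hx
  have hxD : x ∉ D := fun h => by
    have h1 := hmin x h
    have h2 : ∑ i ∈ Finset.range L, dist (x (i + 1)) (f (x i)) ≤ L * (δ / (L + 1)) := by
      simpa using Finset.sum_le_card_nsmul (Finset.range L) _ _ fun i _ => (hx i).le
    have h3 : L * (δ / (L + 1)) < δ := by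
      rw [mul_div_assoc', div_lt_iff₀ (by positivity)]
      nlinarith
    linarith
  simpa [D] using hxD

/-- Concatenation of blocks: itineraries of length `q * L`. -/
theorem exists_words_pseudoOrbit {X : Type*} [MetricSpace X] {f : X → X} {α : Set (Set X)} {L N : ℕ} {ε : ℝ}
    {s : Finset (ℕ → Set X)} (hcard : s.card ≤ N) (hsα : ∀ w ∈ s, ∀ i, w i ∈ α)
    (hs : ∀ x : ℕ → X, (∀ i, dist (x (i + 1)) (f (x i)) < ε) → ∃ w ∈ s, ∀ i < L, x i ∈ w i)
    (hα : ∃ A, A ∈ α) (q : ℕ) :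
    ∃ s' : Finset (ℕ → Set X), s'.card ≤ N ^ q ∧ (∀ w ∈ s', ∀ i, w i ∈ α) ∧
      ∀ x : ℕ → X, (∀ i, dist (x (i + 1)) (f (x i)) < ε) →
        ∃ w ∈ s', ∀ i < q * L, x i ∈ w i := by
  classical
  obtain ⟨A, hA⟩ := hα
  induction q with
  | zero => exact ⟨{fun _ => A}, by simp, by simp [hA], by simp⟩
  | succ q ih =>
    obtain ⟨s', h1, h2, h3⟩ := ih
    refine ⟨Finset.image₂ (fun w v i => if i < q * L then w i else v (i - q * L)) s' s,
      ?_, ?_, ?_⟩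
    · rw [pow_succ]
      exact (Finset.card_image₂_le _ _ _).trans (Nat.mul_le_mul h1 hcard)
    · intro u hu i
      obtain ⟨w, hw, v, hv, rfl⟩ := Finset.mem_image₂.1 hu
      dsimp only
      split_ifs
      exacts [h2 w hw i, hsα v hv _]
    · intro x hx
      obtain ⟨w, hw, hxw⟩ := h3 x hx
      obtain ⟨v, hv, hxv⟩ := hs (fun i => x (i + q * L)) fun i => by
        simpa [add_right_comm] using hx (i + q * L)
      refine ⟨_, Finset.mem_image₂_of_mem hw hv, fun i hi => ?_⟩
      split_ifs with h
      · exact hxw i h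
      · have := hxv (i - q * L) (by rw [add_mul, one_mul] at hi; omega)
        rwa [Nat.sub_add_cancel (not_lt.1 h)] at this

/-- If `g` is locally constant where it differs from `f`, then it takes only finitely many values
at the points where it is `ε`-far from `f`. -/
theorem finite_image_of_locally_const {f g : C(X, X)}
    (h : ∀ x, g x ≠ f x → ∀ᶠ y in 𝓝 x, g y = g x) {ε : ℝ} (hε : 0 < ε) :
    (g '' {x | ε ≤ dist (g x) (f x)}).Finite := by
  have hB : IsCompact {x | ε ≤ dist (g x) (f x)} :=
    (isClosed_le continuous_const (by fun_prop)).isCompact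
  obtain ⟨t, -, ht⟩ := hB.elim_nhds_subcover (fun x => {y | g y = g x}) fun x hx =>
    h x (dist_pos.1 (hε.trans_le hx))
  refine (t.finite_toSet.image g).subset ?_
  rintro _ ⟨y, hy, rfl⟩
  obtain ⟨x, hx, hxy⟩ := Set.mem_iUnion₂.1 (ht hy)
  exact ⟨x, hx, hxy.symm⟩

theorem coverNumber_iteratedJoin_le_card {X : Type*} {f : X → X} {α : Set (Set X)} {n : ℕ}
    {s : Finset (ℕ → Set X)} (hsα : ∀ w ∈ s, ∀ i, w i ∈ α)
    (hs : ∀ x, ∃ w ∈ s, ∀ i < n, f^[i] x ∈ w i) :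
    coverNumber (iteratedJoin f α n) ≤ s.card := by
  classical
  refine (coverNumber_le (s := s.image fun w => ⋂ i : Fin n, f^[(i : ℕ)] ⁻¹' (w i)) ?_ ?_).trans
    Finset.card_image_le
  · intro W hW
    obtain ⟨w, hw, rfl⟩ := Finset.mem_image.1 (Finset.mem_coe.1 hW)
    exact ⟨fun i => w i, fun i => hsα w hw i, rfl⟩
  · refine Set.eq_univ_iff_forall.2 fun x => ?_
    obtain ⟨w, hw, hx⟩ := hs x
    exact ⟨_, Finset.mem_coe.2 (Finset.mem_image_of_mem _ hw),
      Set.mem_iInter.2 fun i => hx i i.2⟩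

/-- An orbit of `g` follows a pseudo-orbit of `f` until it first visits a point where `g` is far
from `f`; from then on it is one of finitely many orbits. -/
theorem exists_coverNumber_iteratedJoin_le {f g : C(X, X)}
    (h : ∀ x, g x ≠ f x → ∀ᶠ y in 𝓝 x, g y = g x) {α : Set (Set X)}
    (hα : IsOpenCoverFamily α) (hne : ∃ A, A ∈ α) (L : ℕ) :
    ∃ m : ℕ, ∀ n q : ℕ, n ≤ q * L → coverNumber (iteratedJoin g α n) ≤
      (1 + n * m) * coverNumber (iteratedJoin f α L) ^ q := by
  classical
  obtain ⟨ε, hε, s, hcard, hsα, hs⟩ := exists_words_pseudoOrbit_block f hα L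
  have hfin := finite_image_of_locally_const h hε
  have hV : ∀ y, ∃ U ∈ α, y ∈ U := fun y => by
    have : y ∈ ⋃₀ α := hα.2 ▸ Set.mem_univ y
    simpa using this
  choose V hVα hyV using hV
  refine ⟨hfin.toFinset.card, fun n q hn => ?_⟩
  obtain ⟨s', hcard', hs'α, hs'⟩ := exists_words_pseudoOrbit hcard hsα hs hne q
  set N := coverNumber (iteratedJoin f α L)
  -- `p` records the first far time `k` and the value of `g` there: follow `w` through time `k`,
  -- then the canonical itinerary of the orbit of that value, which starts at time `k + 1`.
  let F : (ℕ × X) → (ℕ → Set X) → ℕ → Set X := fun p w j =>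
    if j ≤ p.1 then w j else V (g^[j - (p.1 + 1)] p.2)
  refine (coverNumber_iteratedJoin_le_card
    (s := s' ∪ Finset.image₂ F (Finset.range n ×ˢ hfin.toFinset) s') ?_ ?_).trans ?_
  · intro u hu i
    rcases Finset.mem_union.1 hu with hu | hu
    · exact hs'α u hu i
    · obtain ⟨p, -, w, hw, rfl⟩ := Finset.mem_image₂.1 hu
      dsimp only [F]
      split_ifs
      exacts [hs'α w hw i, hVα _]
  · intro x
    by_cases hx : ∃ k, k < n ∧ ε ≤ dist (g (g^[k] x)) (f (g^[k] x))
    · obtain ⟨hkn, hk⟩ := Nat.find_spec hx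
      have hmin := fun j => Nat.find_min hx (m := j)
      set k := Nat.find hx
      -- After the first far time the orbit is continued by a true `f`-orbit, so that the whole
      -- sequence is a pseudo-orbit.
      obtain ⟨w, hw, hxw⟩ := hs' (fun j => if j ≤ k then g^[j] x else f^[j - k] (g^[k] x)) <| by
        intro i
        rcases lt_trichotomy i k with hi | rfl | hi
        · have hi' : i + 1 ≤ k := hi
          have := hmin i hi
          simp only [hi.le, hi', if_true, Function.iterate_succ_apply']
          exact lt_of_not_ge fun h' => this ⟨hi.trans hkn, h'⟩
        · simpa using hε
        · have h1 : ¬ i ≤ k := by omega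
          have h2 : ¬ i + 1 ≤ k := by omega
          have h3 : i + 1 - k = (i - k) + 1 := by omega
          simpa [h1, h2, h3, Function.iterate_succ_apply'] using hε
      refine ⟨F (k, g (g^[k] x)) w, Finset.mem_union_right _ (Finset.mem_image₂_of_mem ?_ hw),
        fun j hj => ?_⟩
      · rw [Finset.mem_product]
        exact ⟨Finset.mem_range.2 hkn, hfin.mem_toFinset.2 ⟨_, hk, rfl⟩⟩
      · dsimp only [F]
        split_ifs with hjk
        · simpa [hjk] using hxw j (hj.trans_le hn)
        · have : g^[j] x = g^[j - (k + 1)] (g (g^[k] x)) := by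
            rw [← Function.iterate_succ_apply' g k x, ← Function.iterate_add_apply,
              Nat.sub_add_cancel (by omega)]
          rw [this]
          exact hyV _
    · push Not at hx
      obtain ⟨w, hw, hxw⟩ := hs' (fun j => if j ≤ n then g^[j] x else f^[j - n] (g^[n] x)) <| by
        intro i
        rcases lt_trichotomy i n with hi | rfl | hi
        · have hi' : i + 1 ≤ n := hi
          simpa only [hi.le, hi', if_true, Function.iterate_succ_apply'] using hx i hi
        · simpa using hε
        · have h1 : ¬ i ≤ n := by omega
          have h2 : ¬ i + 1 ≤ n := by omega
          have h3 : i + 1 - n = (i - n) + 1 := by omega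
          simpa [h1, h2, h3, Function.iterate_succ_apply'] using hε
      refine ⟨w, Finset.mem_union_left _ hw, fun j hj => ?_⟩
      simpa [hj.le] using hxw j (hj.trans_le hn)
  · have h1 := Finset.card_image₂_le F (Finset.range n ×ˢ hfin.toFinset) s'
    rw [Finset.card_product, Finset.card_range] at h1
    calc _ ≤ s'.card + n * hfin.toFinset.card * s'.card :=
          (Finset.card_union_le _ _).trans (Nat.add_le_add_left h1 _)
      _ = (1 + n * hfin.toFinset.card) * s'.card := by ring
      _ ≤ _ := Nat.mul_le_mul_left _ hcard'

/-- Squeeze using `1 + n * m ≤ (1 + m) * n` for `n ≥ 1`. -/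
theorem tendsto_log_one_add_mul_div (m : ℕ) :
    Tendsto (fun n : ℕ => Real.log (1 + n * m) / n) atTop (𝓝 0) := by
  have h1 : Tendsto (fun n : ℕ => Real.log n / n) atTop (𝓝 0) := by
    have := (Real.isLittleO_log_id_atTop.tendsto_div_nhds_zero).comp tendsto_natCast_atTop_atTop
    exact this
  have h2 : Tendsto (fun n : ℕ => Real.log (1 + m) / n) atTop (𝓝 0) :=
    tendsto_const_nhds.div_atTop tendsto_natCast_atTop_atTop
  have h3 := h2.add h1
  rw [add_zero] at h3
  refine squeeze_zero' ?_ ?_ h3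
  · filter_upwards with n
    exact div_nonneg (Real.log_nonneg (by nlinarith [show (0 : ℝ) ≤ n * m by positivity]))
      (Nat.cast_nonneg _)
  · filter_upwards [eventually_ge_atTop 1] with n hn
    have hn' : (1 : ℝ) ≤ n := by exact_mod_cast hn
    rw [← add_div]
    gcongr
    rw [← Real.log_mul (by positivity) (by positivity)]
    exact Real.log_le_log (by positivity) (by nlinarith)

/-- Making a map locally constant on an open set, without changing it elsewhere, does not increase
the entropy. -/
theorem topEntropy_le_of_locally_const {f g : C(X, X)}
    (h : ∀ x, g x ≠ f x → ∀ᶠ y in 𝓝 x, g y = g x) : topEntropy g ≤ topEntropy f := by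
  refine iSup₂_le fun α hα => le_iSup₂_of_le α hα ?_
  obtain ⟨a, ha, hlima⟩ := tendsto_coverEntropyWith g.continuous hα
  obtain ⟨b, hb, hlimb⟩ := tendsto_coverEntropyWith f.continuous hα
  rw [ha, hb, EReal.coe_le_coe_iff]
  rcases isEmpty_or_nonempty X with hX | hX
  · have hgf : g = f := ContinuousMap.ext fun x => (hX.false x).elim
    subst hgf
    exact (tendsto_nhds_unique hlima hlimb).le
  obtain ⟨x₀⟩ := hX
  have hne : ∃ A, A ∈ α := by
    have : x₀ ∈ ⋃₀ α := hα.2 ▸ Set.mem_univ x₀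
    obtain ⟨A, hA, -⟩ := this
    exact ⟨A, hA⟩
  have hpos : ∀ (k : C(X, X)) (n : ℕ), 0 < coverNumber (iteratedJoin k α n) := by
    intro k n
    obtain ⟨s, -, hsc, hsn⟩ := exists_card_eq_coverNumber (hα.iteratedJoin k.continuous n)
    obtain ⟨A, hA, -⟩ : x₀ ∈ ⋃₀ (s : Set (Set X)) := hsc ▸ Set.mem_univ x₀
    exact hsn ▸ Finset.card_pos.2 ⟨A, hA⟩
  -- It suffices to bound the rate of `g` by `log N / L` for each block length `L ≥ 1`: first `n →
  -- ∞` with `L` fixed, then `L → ∞`.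
  refine ge_of_tendsto hlimb ?_
  filter_upwards [eventually_ge_atTop 1] with L hL
  obtain ⟨m, hm⟩ := exists_coverNumber_iteratedJoin_le h hα hne L
  set N := coverNumber (iteratedJoin f α L)
  have hL' : (0 : ℝ) < L := by exact_mod_cast hL
  have hlogN : 0 ≤ Real.log N := Real.log_natCast_nonneg _
  have hlim : Tendsto (fun n : ℕ => Real.log (1 + n * m) / n + (Real.log N / L + Real.log N / n))
      atTop (𝓝 (0 + (Real.log N / L + 0))) :=
    (tendsto_log_one_add_mul_div m).add
      (tendsto_const_nhds.add (tendsto_const_nhds.div_atTop tendsto_natCast_atTop_atTop))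
  rw [zero_add, add_zero] at hlim
  refine le_of_tendsto_of_tendsto hlima hlim ?_
  filter_upwards [eventually_ge_atTop 1] with n hn
  have hn' : (0 : ℝ) < n := by exact_mod_cast hn
  have hbound := hm n (n / L + 1) (by
    have := Nat.div_add_mod n L
    have := Nat.mod_lt n hL
    nlinarith)
  have hN : (0 : ℝ) < N := by exact_mod_cast hpos f L
  have hlog : Real.log (coverNumber (iteratedJoin g α n)) ≤
      Real.log (1 + n * m) + ((n / L : ℕ) + 1) * Real.log N := by
    have h1 : (coverNumber (iteratedJoin g α n) : ℝ) ≤ (1 + n * m) * (N : ℝ) ^ (n / L + 1) := by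
      exact_mod_cast hbound
    have h2 := Real.log_le_log (by exact_mod_cast hpos g n) h1
    rw [Real.log_mul (by positivity) (by positivity), Real.log_pow] at h2
    exact_mod_cast h2
  have hdiv : ((n / L : ℕ) : ℝ) ≤ n / L := Nat.cast_div_le
  calc _ ≤ (Real.log (1 + n * m) + (n / L + 1) * Real.log N) / n := by
        gcongr
        exact hlog.trans (by gcongr)
    _ = _ := by field_simp

end Entropy

/-! ### Flattening a map to a monotone one on an interval -/

section Flatten

/-- The maximum of `f` on `[a, x]` (for `a ≤ x`). -/
noncomputable def segSup (f : C(I, I)) (a x : I) : I :=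
  sSup ((fun s => f (max a (min s x))) '' Set.univ)

/-- The minimum of `f` on `[a, x]` (for `a ≤ x`). -/
noncomputable def segInf (f : C(I, I)) (a x : I) : I :=
  sInf ((fun s => f (max a (min s x))) '' Set.univ)

/-- Clamping parametrises the varying interval by the fixed compact space `I`, so this is the
supremum of a jointly continuous family over a compact set. -/
theorem continuous_segSup : Continuous fun p : C(I, I) × I × I => segSup p.1 p.2.1 p.2.2 := by
  unfold segSup
  exact isCompact_univ.continuous_sSup (f := fun (p : C(I, I) × I × I) (s : I) =>
    p.1 (max p.2.1 (min s p.2.2))) (by simp only [Function.HasUncurry.uncurry, id]; fun_prop)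

theorem continuous_segInf : Continuous fun p : C(I, I) × I × I => segInf p.1 p.2.1 p.2.2 := by
  unfold segInf
  exact isCompact_univ.continuous_sInf (f := fun (p : C(I, I) × I × I) (s : I) =>
    p.1 (max p.2.1 (min s p.2.2))) (by simp only [Function.HasUncurry.uncurry, id]; fun_prop)

theorem image_max_min_eq (f : C(I, I)) {a x : I} (h : a ≤ x) :
    (fun s => f (max a (min s x))) '' Set.univ = f '' Set.Icc a x := by
  ext y
  constructor
  · rintro ⟨s, -, rfl⟩
    exact ⟨_, ⟨le_max_left _ _, max_le h (min_le_right _ _)⟩, rfl⟩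
  · rintro ⟨s, hs, rfl⟩
    exact ⟨s, trivial, by simp [min_eq_left hs.2, max_eq_right hs.1]⟩

theorem exists_eq_segSup (f : C(I, I)) {a x : I} (h : a ≤ x) :
    ∃ y ∈ Set.Icc a x, f y = segSup f a x := by
  rw [segSup, image_max_min_eq f h]
  exact (isCompact_Icc.image f.continuous).sSup_mem ((Set.nonempty_Icc.2 h).image f)

theorem exists_eq_segInf (f : C(I, I)) {a x : I} (h : a ≤ x) :
    ∃ y ∈ Set.Icc a x, f y = segInf f a x := by
  rw [segInf, image_max_min_eq f h]
  exact (isCompact_Icc.image f.continuous).sInf_mem ((Set.nonempty_Icc.2 h).image f)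

theorem le_segSup (f : C(I, I)) {a x y : I} (hy : y ∈ Set.Icc a x) : f y ≤ segSup f a x := by
  rw [segSup, image_max_min_eq f (hy.1.trans hy.2)]
  exact le_sSup (Set.mem_image_of_mem f hy)

theorem segInf_le (f : C(I, I)) {a x y : I} (hy : y ∈ Set.Icc a x) : segInf f a x ≤ f y := by
  rw [segInf, image_max_min_eq f (hy.1.trans hy.2)]
  exact sInf_le (Set.mem_image_of_mem f hy)

theorem segSup_mono (f : C(I, I)) {a x y : I} (hx : a ≤ x) (h : x ≤ y) :
    segSup f a x ≤ segSup f a y := by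
  obtain ⟨z, hz, hzx⟩ := exists_eq_segSup f hx
  exact hzx ▸ le_segSup f ⟨hz.1, hz.2.trans h⟩

theorem segInf_anti (f : C(I, I)) {a x y : I} (hx : a ≤ x) (h : x ≤ y) :
    segInf f a y ≤ segInf f a x := by
  obtain ⟨z, hz, hzx⟩ := exists_eq_segInf f hx
  exact hzx ▸ segInf_le f ⟨hz.1, hz.2.trans h⟩

/-- The map that agrees with `f` outside `[a, b]`, and whose value at `x ∈ [a, b]` is the point of
the interval `f [a, x]` nearest to `f b`. -/
noncomputable def flattenFun (f : C(I, I)) (a b x : I) : I :=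
  -- The clamps make one formula valid everywhere: for `x ≤ a` the interval shrinks to `{x}`, and
  -- for `b ≤ x` the target `f b` becomes `f x`, which is already in range.
  max (segInf f (min x a) x) (min (f (max x b)) (segSup f (min x a) x))

theorem continuous_flattenFun :
    Continuous fun p : (C(I, I) × I × I) × I => flattenFun p.1.1 p.1.2.1 p.1.2.2 p.2 := by
  unfold flattenFun
  refine Continuous.max ?_ (Continuous.min (by fun_prop) ?_)
  · exact continuous_segInf.comp (f := fun p : (C(I, I) × I × I) × I =>
      (p.1.1, min p.2 p.1.2.1, p.2)) (by fun_prop)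
  · exact continuous_segSup.comp (f := fun p : (C(I, I) × I × I) × I =>
      (p.1.1, min p.2 p.1.2.1, p.2)) (by fun_prop)

/-- `flattenFun` as a continuous map. -/
noncomputable def flatten (f : C(I, I)) (a b : I) : C(I, I) :=
  ⟨flattenFun f a b, continuous_flattenFun.comp (f := fun x : I => ((f, a, b), x)) (by fun_prop)⟩

theorem continuous_flatten : Continuous fun p : C(I, I) × I × I => flatten p.1 p.2.1 p.2.2 :=
  ContinuousMap.continuous_of_continuous_uncurry _ continuous_flattenFun

theorem flatten_apply (f : C(I, I)) (a b x : I) : flatten f a b x =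
    max (segInf f (min x a) x) (min (f (max x b)) (segSup f (min x a) x)) := rfl

theorem flatten_eq_of_le_left (f : C(I, I)) {a b x : I} (h : x ≤ a) : flatten f a b x = f x := by
  obtain ⟨y, hy, hy'⟩ := exists_eq_segSup f (le_refl x)
  obtain ⟨z, hz, hz'⟩ := exists_eq_segInf f (le_refl x)
  have hyx : y = x := le_antisymm hy.2 hy.1
  have hzx : z = x := le_antisymm hz.2 hz.1
  rw [flatten_apply, min_eq_left h, ← hy', ← hz', hyx, hzx, max_eq_left (min_le_right _ _)]

theorem flatten_eq_of_right_le (f : C(I, I)) {a b x : I} (h : b ≤ x) : flatten f a b x = f x := by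
  have hx : x ∈ Set.Icc (min x a) x := ⟨min_le_left _ _, le_rfl⟩
  rw [flatten_apply, max_eq_left h, min_eq_left (le_segSup f hx), max_eq_right (segInf_le f hx)]

theorem flatten_eq_of_mem (f : C(I, I)) {a b x : I} (hx : x ∈ Set.Icc a b) :
    flatten f a b x = max (segInf f a x) (min (f b) (segSup f a x)) := by
  rw [flatten_apply, min_eq_right hx.1, max_eq_right hx.2]

/-- Since `f a` lies in the range on `[a, x]` and below `f b`, the lower bound is inactive: what
remains is a running maximum cut off at `f b`. -/
theorem flatten_eq_min (f : C(I, I)) {a b x : I} (hx : x ∈ Set.Icc a b) (h : f a ≤ f b) :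
    flatten f a b x = min (f b) (segSup f a x) := by
  rw [flatten_eq_of_mem f hx, max_eq_right]
  have ha : a ∈ Set.Icc a x := ⟨le_rfl, hx.1⟩
  exact (segInf_le f ha).trans (le_min h (le_segSup f ha))

theorem flatten_eq_max (f : C(I, I)) {a b x : I} (hx : x ∈ Set.Icc a b) (h : f b ≤ f a) :
    flatten f a b x = max (f b) (segInf f a x) := by
  rw [flatten_eq_of_mem f hx, min_eq_left, max_comm]
  exact h.trans (le_segSup f ⟨le_rfl, hx.1⟩)

theorem monotoneOn_or_antitoneOn_flatten (f : C(I, I)) (a b : I) :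
    MonotoneOn (flatten f a b) (Set.Icc a b) ∨ AntitoneOn (flatten f a b) (Set.Icc a b) := by
  rcases le_total (f a) (f b) with h | h
  · left
    intro x hx y hy hxy
    rw [flatten_eq_min f hx h, flatten_eq_min f hy h]
    exact min_le_min_left _ (segSup_mono f hx.1 hxy)
  · right
    intro x hx y hy hxy
    rw [flatten_eq_max f hx h, flatten_eq_max f hy h]
    exact max_le_max_left _ (segInf_anti f hx.1 hxy)

/-- The values of `flatten f a b` are values of `f` at nearby points. -/
theorem exists_flatten_eq (f : C(I, I)) {a b x : I} (hx : x ∈ Set.Icc a b) :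
    ∃ y ∈ Set.Icc a x, flatten f a b x = f y := by
  obtain ⟨y, hy, hy'⟩ := exists_eq_segSup f hx.1
  obtain ⟨z, hz, hz'⟩ := exists_eq_segInf f hx.1
  have hzy : f z ≤ f y := hy' ▸ le_segSup f hz
  have hmem : flatten f a b x ∈ Set.uIcc (f z) (f y) := by
    rw [flatten_eq_of_mem f hx, ← hy', ← hz', Set.uIcc_of_le hzy]
    exact ⟨le_max_left _ _, max_le hzy (min_le_right _ _)⟩
  obtain ⟨w, hw, hw'⟩ := intermediate_value_uIcc f.continuous.continuousOn hmem
  exact ⟨w, Set.uIcc_subset_Icc hz hy hw, hw'.symm⟩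

/-- On an interval on which `flatten f a b` and `f` do not meet, `flatten f a b` is constant. -/
theorem flatten_eq_flatten (f : C(I, I)) {a b y z : I} (hy : a ≤ y) (hyz : y ≤ z) (hz : z ≤ b)
    (h : ∀ w ∈ Set.Icc y z, flatten f a b w ≠ f w) : flatten f a b y = flatten f a b z := by
  have hyI : y ∈ Set.Icc a b := ⟨hy, hyz.trans hz⟩
  have hzI : z ∈ Set.Icc a b := ⟨hy.trans hyz, hz⟩
  rcases le_total (f a) (f b) with hab | hab
  · rw [flatten_eq_min f hyI hab, flatten_eq_min f hzI hab]
    refine le_antisymm (min_le_min_left _ (segSup_mono f hy hyz)) (le_of_not_gt fun hlt => ?_)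
    have hM : segSup f a y < min (f b) (segSup f a z) := by
      refine (min_lt_iff.1 hlt).resolve_left fun h' => absurd (min_le_left (f b) (segSup f a z))
        (not_le.2 h')
    -- If the value rises, a maximiser `w` on `[a, z]` lies beyond `y`, and between them `f` takes
    -- the flattened value at `z`; at such a point `u` the two maps meet.
    obtain ⟨w, hw, hwz⟩ := exists_eq_segSup f (hy.trans hyz)
    have hyw : y ≤ w := le_of_not_ge fun hwy =>
      absurd (le_segSup f ⟨hw.1, hwy⟩) (not_le.2 (hwz ▸ hM.trans_le (min_le_right _ _)))
    obtain ⟨u, hu, hu'⟩ := intermediate_value_Icc hyw f.continuous.continuousOn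
      (show min (f b) (segSup f a z) ∈ Set.Icc (f y) (f w) from
        ⟨(le_segSup f ⟨hy, le_rfl⟩).trans hM.le, hwz ▸ min_le_right _ _⟩)
    have hau : a ≤ u := hy.trans hu.1
    have huz : u ≤ z := hu.2.trans hw.2
    refine h u ⟨hu.1, huz⟩ ?_
    rw [flatten_eq_min f ⟨hau, huz.trans hz⟩ hab]
    refine le_antisymm ?_ (le_min (hu' ▸ min_le_left _ _) (le_segSup f ⟨hau, le_rfl⟩))
    rw [hu']
    exact min_le_min_left _ (segSup_mono f hau huz)
  · rw [flatten_eq_max f hyI hab, flatten_eq_max f hzI hab]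
    refine le_antisymm (le_of_not_gt fun hlt => ?_) (max_le_max_left _ (segInf_anti f hy hyz))
    have hM : max (f b) (segInf f a z) < segInf f a y := by
      refine (lt_max_iff.1 hlt).resolve_left fun h' => absurd (le_max_left (f b) (segInf f a z))
        (not_le.2 h')
    obtain ⟨w, hw, hwz⟩ := exists_eq_segInf f (hy.trans hyz)
    have hyw : y ≤ w := le_of_not_ge fun hwy =>
      absurd (segInf_le f ⟨hw.1, hwy⟩) (not_le.2 (hwz ▸ (le_max_right _ _).trans_lt hM))
    obtain ⟨u, hu, hu'⟩ := intermediate_value_Icc' hyw f.continuous.continuousOn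
      (show max (f b) (segInf f a z) ∈ Set.Icc (f w) (f y) from
        ⟨hwz ▸ le_max_right _ _, hM.le.trans (segInf_le f ⟨hy, le_rfl⟩)⟩)
    have hau : a ≤ u := hy.trans hu.1
    have huz : u ≤ z := hu.2.trans hw.2
    refine h u ⟨hu.1, huz⟩ ?_
    rw [flatten_eq_max f ⟨hau, huz.trans hz⟩ hab]
    refine le_antisymm (max_le (hu' ▸ le_max_left _ _) (segInf_le f ⟨hau, le_rfl⟩)) ?_
    rw [hu']
    exact max_le_max_left _ (segInf_anti f hau huz)

/-- The maps differ on an open set inside `[a, b]`; `flatten_eq_flatten` applies on an interval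
around each of its points. -/
theorem topEntropy_flatten_le (f : C(I, I)) (a b : I) :
    topEntropy (flatten f a b) ≤ topEntropy f := by
  refine topEntropy_le_of_locally_const fun x hx => ?_
  have hU : {y | flatten f a b y ≠ f y} ∈ 𝓝 x :=
    (isOpen_ne_fun (flatten f a b).continuous f.continuous).mem_nhds hx
  obtain ⟨W, hW, hWc, hWU⟩ : ∃ W ∈ 𝓝 x, W.OrdConnected ∧ W ⊆ {y | flatten f a b y ≠ f y} := by
    obtain ⟨c, d, -, hcd, hsub⟩ := exists_Icc_mem_subset_of_mem_nhds hU
    exact ⟨_, hcd, Set.ordConnected_Icc, hsub⟩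
  have hab : ∀ y ∈ W, a ≤ y ∧ y ≤ b := fun y hy =>
    ⟨le_of_not_ge fun h => hWU hy (flatten_eq_of_le_left f h),
      le_of_not_ge fun h => hWU hy (flatten_eq_of_right_le f h)⟩
  have hxW := mem_of_mem_nhds hW
  filter_upwards [hW] with y hy
  rcases le_total x y with h | h
  · exact (flatten_eq_flatten f (hab x hxW).1 h (hab y hy).2
      fun w hw => hWU (hWc.out hxW hy hw)).symm
  · exact flatten_eq_flatten f (hab y hy).1 h (hab x hxW).2 fun w hw => hWU (hWc.out hy hxW hw)

end Flatten

/-! ### The deformation -/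

section Deformation

/-- The point `min (k t) 1`. -/
noncomputable def gridPoint (k : ℕ) (t : I) : I :=
  ⟨min (k * t) 1, le_min (mul_nonneg k.cast_nonneg t.2.1) zero_le_one, min_le_right _ _⟩

theorem continuous_gridPoint (k : ℕ) : Continuous (gridPoint k) := by
  unfold gridPoint
  fun_prop

theorem gridPoint_mono (t : I) : Monotone fun k => gridPoint k t := by
  intro k l h
  have ht := t.2.1
  exact Subtype.mk_le_mk.2 (min_le_min_right _ (by gcongr))

theorem gridPoint_succ_le (k : ℕ) (t : I) :
    (gridPoint (k + 1) t : ℝ) ≤ gridPoint k t + t := by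
  have ht := t.2.1
  simp only [gridPoint, Nat.cast_add, Nat.cast_one, add_mul, one_mul]
  rcases min_cases ((k : ℝ) * t) 1 with h | h <;> rw [h.1]
  · exact min_le_left _ _
  · exact (min_le_right _ _).trans (by linarith)

theorem gridPoint_zero_left (t : I) : gridPoint 0 t = 0 := by
  ext; simp [gridPoint]

theorem gridPoint_zero_right (k : ℕ) : gridPoint k 0 = 0 := by
  ext; simp [gridPoint]

theorem gridPoint_eq_one {k : ℕ} {t : I} (h : 1 ≤ k * (t : ℝ)) : gridPoint k t = 1 := by
  ext; simp [gridPoint, h]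

/-- Flatten `f` successively on the first `n` intervals of the grid of mesh `t`. -/
noncomputable def flattenGrid : ℕ → C(I, I) → I → C(I, I)
  | 0, f, _ => f
  | n + 1, f, t => flatten (flattenGrid n f t) (gridPoint n t) (gridPoint (n + 1) t)

theorem continuous_flattenGrid (n : ℕ) :
    Continuous fun p : C(I, I) × I => flattenGrid n p.1 p.2 := by
  induction n with
  | zero => exact continuous_fst
  | succ n ih =>
    exact continuous_flatten.comp (ih.prodMk
      (((continuous_gridPoint n).comp continuous_snd).prodMk
        ((continuous_gridPoint (n + 1)).comp continuous_snd)))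

theorem flattenGrid_zero (n : ℕ) (f : C(I, I)) : flattenGrid n f 0 = f := by
  induction n with
  | zero => rfl
  | succ n ih =>
    ext x
    rw [flattenGrid, gridPoint_zero_right, gridPoint_zero_right, ih,
      flatten_eq_of_right_le f unitInterval.nonneg']

/-- Once the grid has reached 1, the remaining intervals are `[1, 1]` and change nothing. Hence the
number of steps can be taken constant for `t` near a positive value. -/
theorem flattenGrid_eq {n : ℕ} {t : I} (h : 1 ≤ n * (t : ℝ)) (f : C(I, I)) {m : ℕ} (hm : n ≤ m) :
    flattenGrid m f t = flattenGrid n f t := by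
  induction m, hm using Nat.le_induction with
  | base => rfl
  | succ m hm ih =>
    ext x
    have h1 : (1 : I) ≤ gridPoint m t := gridPoint_eq_one h ▸ gridPoint_mono t hm
    rw [flattenGrid, flatten_eq_of_le_left _ (unitInterval.le_one'.trans h1), ih]

theorem flattenGrid_eq_of_le (n : ℕ) (f : C(I, I)) {t x : I} (h : gridPoint n t ≤ x) :
    flattenGrid n f t x = f x := by
  induction n with
  | zero => rfl
  | succ n ih =>
    rw [flattenGrid, flatten_eq_of_right_le _ h, ih ((gridPoint_mono t n.le_succ).trans h)]

/-- Each step acts on one interval, and to the right of its left endpoint the earlier steps have not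
yet changed `f`; so displacements do not accumulate. -/
theorem exists_flattenGrid_eq (n : ℕ) (f : C(I, I)) (t x : I) :
    ∃ y, dist y x ≤ t ∧ flattenGrid n f t x = f y := by
  induction n with
  | zero => exact ⟨x, by simpa using t.2.1, rfl⟩
  | succ n ih =>
    rcases le_total x (gridPoint n t) with h1 | h1
    · rwa [flattenGrid, flatten_eq_of_le_left _ h1]
    rcases le_total (gridPoint (n + 1) t) x with h2 | h2
    · exact ⟨x, by simpa using t.2.1, flattenGrid_eq_of_le _ f h2⟩
    · obtain ⟨y, hy, hy'⟩ := exists_flatten_eq (flattenGrid n f t) ⟨h1, h2⟩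
      refine ⟨y, ?_, ?_⟩
      · rw [Subtype.dist_eq, Real.dist_eq, abs_sub_comm, abs_of_nonneg (sub_nonneg.2 (Subtype.coe_le_coe.2 hy.2))]
        have h3 := gridPoint_succ_le n t
        have h4 : (x : ℝ) ≤ gridPoint (n + 1) t := h2
        have h5 : (gridPoint n t : ℝ) ≤ y := hy.1
        linarith
      · rw [flattenGrid, hy', flattenGrid_eq_of_le n f hy.1]

theorem topEntropy_flattenGrid_le (n : ℕ) (f : C(I, I)) (t : I) :
    topEntropy (flattenGrid n f t) ≤ topEntropy f := by
  induction n with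
  | zero => exact le_rfl
  | succ n ih => exact (topEntropy_flatten_le _ _ _).trans ih

/-- Step `k + 1` creates monotonicity on this interval, and later steps act only to its right. -/
theorem monotoneOn_or_antitoneOn_flattenGrid (f : C(I, I)) (t : I) {k n : ℕ} (h : k < n) :
    MonotoneOn (flattenGrid n f t) (Set.Icc (gridPoint k t) (gridPoint (k + 1) t)) ∨
      AntitoneOn (flattenGrid n f t) (Set.Icc (gridPoint k t) (gridPoint (k + 1) t)) := by
  induction n, h using Nat.le_induction with
  | base => exact monotoneOn_or_antitoneOn_flatten _ _ _
  | succ n hn ih =>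
    have heq : Set.EqOn (flattenGrid n f t) (flattenGrid (n + 1) f t)
        (Set.Icc (gridPoint k t) (gridPoint (k + 1) t)) := fun x hx =>
      (flatten_eq_of_le_left _ (hx.2.trans (gridPoint_mono t hn))).symm
    exact ih.imp (fun h => h.congr heq) fun h => h.congr heq

/-- Flatten `f` on all intervals of the grid of mesh `t` (and do nothing for `t = 0`). -/
noncomputable def flattenMesh (f : C(I, I)) (t : I) : C(I, I) :=
  flattenGrid ⌈(1 / t : ℝ)⌉₊ f t

theorem one_le_ceil_mul {t : I} {s : ℝ} (hs : 0 < s) (hst : s ≤ t) :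
    1 ≤ (⌈1 / s⌉₊ : ℝ) * (t : ℝ) := by
  have h := Nat.le_ceil (1 / s)
  rw [div_le_iff₀ hs] at h
  exact h.trans (by gcongr)

theorem continuous_flattenMesh : Continuous fun p : C(I, I) × I => flattenMesh p.1 p.2 := by
  rw [continuous_iff_continuousAt]
  rintro ⟨f₀, t₀⟩
  rcases eq_or_lt_of_le (unitInterval.nonneg' (t := t₀)) with rfl | ht₀
  · have h0 : flattenMesh f₀ 0 = f₀ := flattenGrid_zero _ _
    rw [Metric.continuousAt_iff]
    intro ε hε
    obtain ⟨δ, hδ, hf₀⟩ := Metric.uniformContinuous_iff.1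
      (CompactSpace.uniformContinuous_of_continuous f₀.continuous) (ε / 3) (by positivity)
    refine ⟨min δ (ε / 3), by positivity, ?_⟩
    rintro ⟨f, t⟩ hft
    obtain ⟨hf, ht⟩ := max_lt_iff.1 (Prod.dist_eq.symm.trans_lt hft)
    simp only [h0]
    refine ((ContinuousMap.dist_le (by positivity : (0 : ℝ) ≤ ε / 3 + ε / 3)).2 fun x => ?_).trans_lt
      (by linarith)
    -- The bound does not depend on the number of steps; uniform continuity of `f₀` then compares
    -- `f₀ y` with `f₀ x`.
    obtain ⟨y, hy, hy'⟩ := exists_flattenGrid_eq ⌈(1 / t : ℝ)⌉₊ f t x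
    rw [flattenMesh, hy']
    have htδ : (t : ℝ) < δ := by
      have := ht.trans_le (min_le_left _ _)
      rwa [Subtype.dist_eq, Real.dist_eq, Set.Icc.coe_zero, sub_zero,
        abs_of_nonneg t.2.1] at this
    have h1 : dist (f y) (f₀ y) ≤ ε / 3 :=
      (ContinuousMap.dist_apply_le_dist y).trans (hf.trans_le (min_le_right _ _)).le
    have h2 := hf₀ (hy.trans_lt htδ)
    linarith [dist_triangle (f y) (f₀ y) (f₀ x)]
  · have ht : (0 : ℝ) < t₀ := ht₀
    -- `⌈2 / t₀⌉` steps suffice for every `t > t₀ / 2`.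
    refine (continuous_flattenGrid ⌈(1 / (t₀ / 2) : ℝ)⌉₊).continuousAt.congr ?_
    have hev : ∀ᶠ p : C(I, I) × I in 𝓝 (f₀, t₀), (t₀ / 2 : ℝ) < p.2 :=
      (continuous_subtype_val.comp continuous_snd).continuousAt.eventually
        (lt_mem_nhds (show (t₀ / 2 : ℝ) < t₀ by linarith))
    filter_upwards [hev] with p hp
    have hp0 : (0 : ℝ) < p.2 := by linarith
    refine flattenGrid_eq (one_le_ceil_mul hp0 le_rfl) _ (Nat.ceil_mono ?_)
    gcongr

/-- The cutoff changes `f` only on the open set where `f > c`, and there it is constantly `c`. -/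
theorem topEntropy_inf_const_le (f : C(I, I)) (c : I) :
    topEntropy (f ⊓ ContinuousMap.const I c) ≤ topEntropy f := by
  refine topEntropy_le_of_locally_const fun x hx => ?_
  have hcx : c < f x := lt_of_not_ge fun h => hx (by simp [h])
  filter_upwards [f.continuous.continuousAt.eventually (lt_mem_nhds hcx)] with y hy
  simp [hcx.le, hy.le]

/-- Indices below `⌈1 / t⌉` give points below 1, so the grid is strict up to that index, as a
partition in `IsPiecewiseMonotone` must be. -/
theorem gridPoint_lt_gridPoint {t : I} (ht : 0 < t) {k l : ℕ} (hkl : k < l)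
    (hl : l ≤ ⌈(1 / t : ℝ)⌉₊) : gridPoint k t < gridPoint l t := by
  have ht' : (0 : ℝ) < t := ht
  have hk : (k : ℝ) * t < 1 := (lt_div_iff₀ ht').1 (Nat.lt_ceil.1 (hkl.trans_le hl))
  refine Subtype.mk_lt_mk.2 ?_
  rw [min_eq_left hk.le]
  exact lt_min (by gcongr) hk

theorem isPiecewiseMonotone_flattenMesh_inf_const (f : C(I, I)) {t : I} (ht : 0 < t) (c : I) :
    IsPiecewiseMonotone (flattenMesh f t ⊓ ContinuousMap.const I c) := by
  refine ⟨⌈(1 / t : ℝ)⌉₊, fun k => gridPoint k t,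
    fun k l hkl => gridPoint_lt_gridPoint ht hkl (Nat.lt_succ_iff.1 l.2), gridPoint_zero_left t,
    gridPoint_eq_one (one_le_ceil_mul ht le_rfl), fun i => ?_⟩
  refine (monotoneOn_or_antitoneOn_flattenGrid f t i.2).imp (fun h x hx y hy hxy => ?_)
    fun h x hx y hy hxy => ?_
  · exact min_le_min_right _ (h hx hy hxy)
  · exact min_le_min_right _ (h hx hy hxy)

end Deformation

theorem theorem2 :
    ∃ H : C(C(I, I) × I, C(I, I)),
      (∀ f : C(I, I), H (f, 0) = f) ∧
      (∀ t : I, 0 < t → t < 1 → ∀ f : C(I, I),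
        topEntropy (H (f, t)) ≤ topEntropy f ∧ IsPiecewiseMonotone (H (f, t))) ∧
      (∀ f : C(I, I), H (f, 1) = ContinuousMap.const I 0) := by
  refine ⟨⟨fun p => flattenMesh p.1 p.2 ⊓ ContinuousMap.const I (σ p.2), ?_⟩, fun f => ?_,
    fun t ht _ f => ⟨?_, ?_⟩, fun f => ?_⟩
  · refine ContinuousMap.continuous_of_continuous_uncurry _ ?_
    have h : Continuous fun q : (C(I, I) × I) × I => flattenMesh q.1.1 q.1.2 :=
      continuous_flattenMesh.comp continuous_fst
    exact (h.eval continuous_snd).min (unitInterval.continuous_symm.comp (by fun_prop))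
  · ext x
    simp [flattenMesh, flattenGrid_zero, unitInterval.le_one']
  · exact (topEntropy_inf_const_le _ _).trans (topEntropy_flattenGrid_le _ _ _)
  · exact isPiecewiseMonotone_flattenMesh_inf_const f ht _
  · ext x
    simp
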